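/- Let $(X,d)$ be an unbounded noncomplete metric space, let $\overline X$ be its completion and $\partial X=\overline X\setminus X$ its metric boundary with the metric $d$. Write $d(x)$ for the distance from $x\in X$ to $\partial X$, and assume $d(x)>0$ for all $x\in X$. Put $$\widetilde j(x,y)=\tfrac12\log\Big[\Big(1+\frac{d(x,y)}{d(x)}\Big)\Big(1+\frac{d(x,y)}{d(y)}\Big)\Big],\qquad (x|y)_w=\tfrac12\big[\widetilde j(x,w)+\widetilde j(y,w)-\widetilde j(x,y)\big].$$ *Notation.* The metric $\widetilde j$ is $\delta$-hyperbolic ($\delta\ge 0$) if $(x|y)_w\ge\min\{(x|z)_w,(z|y)_w\}-\delta$ for all $x,y,z,w\in X$. The boundary at infinity $\partial_{\widetilde j}X$ is the set of classes of sequences with $(x_i|x_k)_w\to\infty$ as $i,k\to\infty$, where $\{x_i\}\sim\{y_i\}$ if $(x_i|y_i)_w\to\infty$. A Gromov product involving points of $\partial_{\widetilde j}X$ is the infimum of $\liminf_i$ of the products along sequences representing these points. The Gromov closure $X\cup\partial_{\widetilde j}X$ has the topology in which a set $U$ is open iff it contains a $\widetilde j$-ball around each of its points in $X$ and, for each $\zeta\in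 U\cap\partial_{\widetilde j}X$ and $w\in X$, a set $\{z:(z|\zeta)_w>R\}$ for some $R\in\mathbb R$. The space $\overline X\cup\{\infty\}$ has the topology in which $\overline X$ is open with its metric topology and the neighbourhoods of $\infty$ are those of its open neighbourhoods whose complement is bounded, together with their supersets. A *natural map* is a continuous map $\psi:X\cup\partial_{\widetilde j}X\to\overline X\cup\{\infty\}$ that is the identity on $X$ and maps $\partial_{\widetilde j}X$ into $\partial X\cup\{\infty\}$. For $\xi\in\partial_{\widetilde j}X$, the set $\mathcal B_{\widetilde j}(\xi)$ consists of the Busemann functions $b(x)=(\xi|w)_x-(\xi|x)_w$, $w\in X$. For such $b$ put $(x|y)_b=\frac12[b(x)+b(y)-\widetilde j(x,y)]$, extended to pairs of points of $\partial_{\widetilde j}X\setminus\{\xi\}$ by the infimum of $\liminf$ as above, and $$\widetilde j_{b,\varepsilon}(\zeta,\zeta')=\inf\Big\{\sum_{i=1}^n e^{-\varepsilon(\zeta_{i-1}|\zeta_i)_b}:\ n\ge1,\ \zeta=\zeta_0,\zeta_1,\dots,\zeta_n=\zeta'\in\partial_{\widetilde j}X\setminus\{\xi\}\Big\},\qquad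 e^{-\infty}=0.$$ A homeomorphism $f$ between metric spaces is $\eta$-quasisymmetric, for a homeomorphism $\eta:[0,\infty)\to[0,\infty)$, if for all $t>0$ and all points $x,y,z$, $|x-y|\le t|x-z|$ implies $|f(x)-f(y)|\le\eta(t)|f(x)-f(z)|$ (here $|\cdot-\cdot|$ denotes the distance). *Statement.* The function $\widetilde j$ is a metric on $X$, and it is Gromov hyperbolic with a universal constant $\delta_0\ge 0$. There are a natural map $\psi$ and a point $\xi\in\partial_{\widetilde j}X$ with $\psi(\xi)=\infty$ such that the following holds for every $\varepsilon>0$, every $\delta\ge0$ for which $\widetilde j$ is $\delta$-hyperbolic and $e^{22\varepsilon\delta}\le2$, and every $b\in\mathcal B_{\widetilde j}(\xi)$: the function $\widetilde j_{b,\varepsilon}$ is a metric (the Hamenstädt metric), and $\psi$ restricts to an $\widetilde\eta$-quasisymmetric homeomorphism $$\widetilde\varphi:(\partial_{\widetilde j}X\setminus\{\xi\},\widetilde j_{b,\varepsilon})\to(\partial X,d)$$ onto $\partial X$, where $\widetilde\eta$ depends only on $\varepsilon$ (not on $X$, $\delta$ or $b$). -/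

import Mathlib

open Filter Topology UniformSpace
open scoped NNReal ENNReal

universe u

noncomputable section

/-! ### Metrics given by distance functions, quasisymmetric maps -/

/-- A function `m` is a metric on `X`. -/
structure IsMetric {X : Type*} (m : X → X → ℝ) : Prop where
  eq_zero_iff : ∀ x y, m x y = 0 ↔ x = y
  symm : ∀ x y, m x y = m y x
  triangle : ∀ x y z, m x z ≤ m x y + m y z

/-- The metric space (with its metric topology) determined by a metric. -/
@[reducible]
def IsMetric.toMetricSpace {X : Type*} {m : X → X → ℝ} (h : IsMetric m) : MetricSpace X where
  dist := m
  dist_self x := (h.eq_zero_iff x x).2 rfl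
  dist_comm := h.symm
  dist_triangle := h.triangle
  eq_of_dist_eq_zero {x y} hxy := (h.eq_zero_iff x y).1 hxy

/-- A homeomorphism `f` between metric spaces is `η`-quasisymmetric, where `η` is a homeomorphism
of `[0, ∞)` onto itself. -/
def IsQuasisymmetric {A B : Type*} [MetricSpace A] [MetricSpace B]
    (η : ℝ≥0 ≃ₜ ℝ≥0) (f : A ≃ₜ B) : Prop :=
  ∀ t : ℝ≥0, 0 < t → ∀ x y z : A,
    dist x y ≤ t * dist x z → dist (f x) (f y) ≤ η t * dist (f x) (f z)

/-! ### The metric boundary and the metric `j̃` -/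

/-- The metric boundary `∂X`: the points of the completion that do not belong to `X`.  As a
subtype of the completion it carries the restriction of the metric. -/
abbrev MetricBoundary (X : Type*) [MetricSpace X] : Type _ :=
  {z : Completion X // z ∉ Set.range ((↑) : X → Completion X)}

/-- `d(x)`, the distance from `x` to the metric boundary. -/
def bdryDist {X : Type*} [MetricSpace X] (x : X) : ℝ :=
  Metric.infDist (x : Completion X) (Set.range ((↑) : X → Completion X))ᶜ

/-- The function `j̃`. -/
def jTilde (X : Type*) [MetricSpace X] (x y : X) : ℝ :=
  (1 / 2) * Real.log ((1 + dist x y / bdryDist x) * (1 + dist x y / bdryDist y))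

/-! ### Gromov hyperbolicity and the boundary at infinity of `(X, m)` -/

section Gromov

variable {X : Type*} (m : X → X → ℝ)

/-- The Gromov product `(x|y)_w`. -/
def gromovProd (w x y : X) : ℝ := (m x w + m y w - m x y) / 2

/-- The Gromov `δ`-inequality for `m`. -/
def IsGromovHyperbolic (δ : ℝ) : Prop :=
  0 ≤ δ ∧ ∀ x y z w : X,
    min (gromovProd m w x z) (gromovProd m w z y) - δ ≤ gromovProd m w x y

/-- Gromov sequences: `(x_i|x_j)_w → ∞` as `i, j → ∞`. -/
def IsGromovSeq (x : ℕ → X) : Prop :=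
  ∀ w : X, Tendsto (fun p : ℕ × ℕ => gromovProd m w (x p.1) (x p.2)) atTop atTop

/-- Equivalence of Gromov sequences: `(x_i|y_i)_w → ∞`. -/
def GromovEquiv (x y : ℕ → X) : Prop :=
  ∀ w : X, Tendsto (fun i : ℕ => gromovProd m w (x i) (y i)) atTop atTop

/-- The boundary at infinity: the set of equivalence classes of Gromov sequences. -/
def GromovBoundary : Type _ :=
  {A : Set (ℕ → X) // ∃ x, IsGromovSeq m x ∧ A = {y | IsGromovSeq m y ∧ GromovEquiv m x y}}

variable {m}

/-- The set of Gromov sequences that belong to a point of the boundary at infinity. -/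
def GromovBoundary.seqs (ζ : GromovBoundary m) : Set (ℕ → X) := ζ.1

variable (m)

/-- The Gromov product `(a|ζ)_w` of `a ∈ X` and a boundary point `ζ`. -/
def gromovProdPt (w a : X) (ζ : GromovBoundary m) : EReal :=
  ⨅ z ∈ ζ.seqs, liminf (fun i : ℕ => ((gromovProd m w a (z i) : ℝ) : EReal)) atTop

/-- The Gromov product `(ζ₁|ζ₂)_w` of two boundary points. -/
def gromovProdBdry (w : X) (ζ₁ ζ₂ : GromovBoundary m) : EReal :=
  ⨅ x ∈ ζ₁.seqs, ⨅ y ∈ ζ₂.seqs,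
    liminf (fun i : ℕ => ((gromovProd m w (x i) (y i) : ℝ) : EReal)) atTop

/-- The Gromov closure `X ∪ ∂_m X`. -/
def GromovClosure : Type _ := X ⊕ GromovBoundary m

variable {m}

/-- Points of `X` in the Gromov closure. -/
def GromovClosure.pt (x : X) : GromovClosure m := Sum.inl x

/-- Boundary points in the Gromov closure. -/
def GromovClosure.bdry (ζ : GromovBoundary m) : GromovClosure m := Sum.inr ζ

variable (m)

/-- The topology of the Gromov closure: neighbourhoods of `x ∈ X` contain an `m`-ball around `x`,
and neighbourhoods of a boundary point `ζ` contain a set `{z | (z|ζ)_w > R}`. -/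
instance GromovClosure.instTopologicalSpace : TopologicalSpace (GromovClosure m) where
  IsOpen U :=
    (∀ x : X, pt x ∈ U → ∃ r : ℝ, 0 < r ∧ ∀ y : X, m x y < r → pt y ∈ U) ∧
    (∀ ζ : GromovBoundary m, bdry ζ ∈ U → ∀ w : X, ∃ R : ℝ,
      (∀ y : X, (R : EReal) < gromovProdPt m w y ζ → pt y ∈ U) ∧
      (∀ ζ' : GromovBoundary m, (R : EReal) < gromovProdBdry m w ζ' ζ → bdry ζ' ∈ U))
  isOpen_univ := ⟨fun _ _ => ⟨1, one_pos, fun _ _ => trivial⟩,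
    fun _ _ _ => ⟨0, fun _ _ => trivial, fun _ _ => trivial⟩⟩
  isOpen_inter U V hU hV := by
    refine ⟨fun x hx => ?_, fun ζ hζ w => ?_⟩
    · obtain ⟨r, hr, h⟩ := hU.1 x hx.1
      obtain ⟨s, hs, k⟩ := hV.1 x hx.2
      exact ⟨min r s, lt_min hr hs, fun y hy =>
        ⟨h y (hy.trans_le (min_le_left _ _)), k y (hy.trans_le (min_le_right _ _))⟩⟩
    · obtain ⟨R, h, h'⟩ := hU.2 ζ hζ.1 w
      obtain ⟨S, k, k'⟩ := hV.2 ζ hζ.2 w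
      have hR : (R : EReal) ≤ (max R S : ℝ) := EReal.coe_le_coe_iff.2 (le_max_left _ _)
      have hS : (S : EReal) ≤ (max R S : ℝ) := EReal.coe_le_coe_iff.2 (le_max_right _ _)
      exact ⟨max R S, fun y hy => ⟨h y (hR.trans_lt hy), k y (hS.trans_lt hy)⟩,
        fun y hy => ⟨h' y (hR.trans_lt hy), k' y (hS.trans_lt hy)⟩⟩
  isOpen_sUnion 𝒰 h𝒰 := by
    refine ⟨fun x ⟨U, hU, hx⟩ => ?_, fun ζ ⟨U, hU, hζ⟩ w => ?_⟩
    · obtain ⟨r, hr, h⟩ := (h𝒰 U hU).1 x hx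
      exact ⟨r, hr, fun y hy => ⟨U, hU, h y hy⟩⟩
    · obtain ⟨R, h, h'⟩ := (h𝒰 U hU).2 ζ hζ w
      exact ⟨R, fun y hy => ⟨U, hU, h y hy⟩, fun y hy => ⟨U, hU, h' y hy⟩⟩

/-! ### Busemann functions and Hamenstädt metrics -/

/-- The function `b_{ξ,w}(x) = (ξ|w)_x - (ξ|x)_w`; both Gromov products are finite. -/
def busemann (ξ : GromovBoundary m) (w x : X) : ℝ :=
  (gromovProdPt m x w ξ).toReal - (gromovProdPt m w x ξ).toReal

/-- `𝓑(ξ)`, the set of Busemann functions based at `ξ`. -/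
def busemannFunctions (ξ : GromovBoundary m) : Set (X → ℝ) :=
  {b | ∃ w : X, b = busemann m ξ w}

/-- The Gromov product `(x|y)_b` based at a Busemann function `b`. -/
def gromovProdBus (b : X → ℝ) (x y : X) : ℝ := (b x + b y - m x y) / 2

/-- The Gromov product `(ζ₁|ζ₂)_b` of two boundary points, based at a Busemann function `b`. -/
def gromovProdBusBdry (b : X → ℝ) (ζ₁ ζ₂ : GromovBoundary m) : EReal :=
  ⨅ x ∈ ζ₁.seqs, ⨅ y ∈ ζ₂.seqs,
    liminf (fun i : ℕ => ((gromovProdBus m b (x i) (y i) : ℝ) : EReal)) atTop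

/-- `ρ_{b,ε}(ζ₁, ζ₂) = exp (-ε (ζ₁|ζ₂)_b)`, where `exp (-∞) = 0`. -/
def rhoBus (b : X → ℝ) (ε : ℝ) (ζ₁ ζ₂ : GromovBoundary m) : ℝ :=
  (EReal.exp (-((ε : EReal) * gromovProdBusBdry m b ζ₁ ζ₂))).toReal

variable {m}

/-- The punctured boundary at infinity `∂_m X ∖ {ξ}`. -/
def PuncturedBoundary (ξ : GromovBoundary m) : Type _ := {ζ : GromovBoundary m // ζ ≠ ξ}

/-- A point of the punctured boundary as a point of the boundary. -/
def PuncturedBoundary.val {ξ : GromovBoundary m} (ζ : PuncturedBoundary ξ) : GromovBoundary m :=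
  Subtype.val ζ

/-- The Hamenstädt metric on `∂_m X ∖ {ξ}` with parameter `ε`: the infimum of the sums of
`ρ_{b,ε}` along finite chains in `∂_m X ∖ {ξ}`. -/
def hamenstadt (ξ : GromovBoundary m) (b : X → ℝ) (ε : ℝ) (x y : PuncturedBoundary ξ) : ℝ :=
  sInf {s : ℝ | ∃ (n : ℕ) (c : ℕ → PuncturedBoundary ξ), 1 ≤ n ∧ c 0 = x ∧ c n = y ∧
    s = ∑ i ∈ Finset.range n, rhoBus m b ε (c i).val (c (i + 1)).val}

end Gromov

/-! ### Natural maps -/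

/-- `Y ∪ {∞}` for a metric space `Y`. -/
def MetricExt (Y : Type*) : Type _ := Option Y

/-- Points of `Y` in `Y ∪ {∞}`. -/
def MetricExt.pt {Y : Type*} (y : Y) : MetricExt Y := some y

/-- The point `∞`. -/
def MetricExt.infty {Y : Type*} : MetricExt Y := none

/-- The topology of `Y ∪ {∞}`: `Y` is open and has its own topology, and the open neighbourhoods
of `∞` are the open sets containing `∞` whose complement is bounded. -/
instance MetricExt.instTopologicalSpace (Y : Type*) [MetricSpace Y] :
    TopologicalSpace (MetricExt Y) where
  IsOpen U := IsOpen {y : Y | pt y ∈ U} ∧ (infty ∈ U → Bornology.IsBounded {y : Y | pt y ∉ U})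
  isOpen_univ := by simp
  isOpen_inter U V hU hV := by
    refine ⟨hU.1.inter hV.1, fun h => ((hU.2 h.1).union (hV.2 h.2)).subset ?_⟩
    intro y hy
    by_cases hyU : pt y ∈ U
    · exact Or.inr fun hyV => hy ⟨hyU, hyV⟩
    · exact Or.inl hyU
  isOpen_sUnion 𝒰 h𝒰 := by
    refine ⟨?_, fun ⟨U, hU, h⟩ => ((h𝒰 U hU).2 h).subset fun y hy hyU => hy ⟨U, hU, hyU⟩⟩
    have : {y : Y | pt y ∈ ⋃₀ 𝒰} = ⋃ U ∈ 𝒰, {y : Y | pt y ∈ U} := by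
      ext y
      simp
    rw [this]
    exact isOpen_biUnion fun U hU => (h𝒰 U hU).1

/-- `ψ` is a natural map: a continuous extension to the Gromov closure of the identity map
`(X, m) → (X, d)`, which maps the boundary at infinity of `(X, m)` to `∂X ∪ {∞}`. -/
structure IsNaturalMap {X : Type*} [MetricSpace X] {m : X → X → ℝ}
    (ψ : GromovClosure m → MetricExt (Completion X)) : Prop where
  continuous : Continuous ψ
  extends_id : ∀ x : X, ψ (GromovClosure.pt x) = MetricExt.pt (x : Completion X)
  maps_boundary : ∀ ζ : GromovBoundary m, ψ (GromovClosure.bdry ζ) = MetricExt.infty ∨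
    ∃ z : MetricBoundary X, ψ (GromovClosure.bdry ζ) = MetricExt.pt (z : Completion X)

end

/-!
On the completion of `X` let `d(p)` be the distance to the metric boundary and put
`k(p, q) = √((d(p) + |p - q|) (d(q) + |p - q|))`. Then `j̃(x, y) = log k(x, y) - ½ log d(x) - ½ log d(y)`,
so that all one-point terms except the one of the base point cancel in Gromov products:
`(x|y)_w = ½ log (k(x, w) k(y, w) / (k(x, y) d(w)))`, see `gromovProd_jTilde`. Since `k` is comparable
to `d(p) + d(q) + |p - q|`, it is a metric-like kernel up to a factor `2`, and the cross-difference
inequality `kernel_four_point` gives Gromov hyperbolicity with a universal constant.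

The formula shows that `(x|y)_w` extends continuously to pairs of points of `X̄ ∪ {∞}` as `gromovLim`
(`tendsto_gromovProd`), and that a sequence is a Gromov sequence exactly if it goes to infinity or
converges to a point of the metric boundary (`exists_tendsto_of_isGromovSeq`). Hence the boundary at
infinity is `∂X ∪ {∞}` (`endEquiv`), every lower limit along representing sequences is a limit, and
the natural map is continuous.

As `k(x, y) / k(x, w) → 1` when `x → ∞`, the Busemann functions based at `∞` are exactly
`b(x) = ½ log (d(w) / d(x))`, and `(x|y)_b = ½ log (d(w) / k(x, y))`. On `∂X` the kernel is the metric,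
so `ρ_{b,ε}(z, z') = (|z - z'| / d(w)) ^ (ε / 2)` without any error term (`rhoBus_endEquiv`). Sending
the base point to infinity in the `δ`-inequality shows that the metric of `∂X` is an
`exp (2 δ)`-quasi-ultrametric, so `ρ_{b,ε}` is an `exp (ε δ)`-quasi-ultrametric with
`exp (ε δ) ^ 2 ≤ 2`. Frink's chain lemma then gives `ρ_{b,ε} / 2 ≤ j̃_{b,ε} ≤ ρ_{b,ε}`: the natural map
is bi-Lipschitz up to the power `ε / 2`, hence quasisymmetric with `η(t) = (2 t) ^ (2 / ε)`.
-/

noncomputable section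

/-! ### The kernel `k` and the metric `j̃` -/

section Kernel

variable {X : Type*} [MetricSpace X]

/-- The distance of a point of the completion to the metric boundary, extending `bdryDist`. -/
def bdryDistC (p : Completion X) : ℝ :=
  Metric.infDist p (Set.range ((↑) : X → Completion X))ᶜ

/-- The kernel `k(p, q) = √((d(p) + |p - q|) (d(q) + |p - q|))` on the completion; it is the part
of `exp j̃` that is left after removing the factors depending on one point only. -/
def kernel (p q : Completion X) : ℝ :=
  √((bdryDistC p + dist p q) * (bdryDistC q + dist p q))

lemma bdryDistC_nonneg (p : Completion X) : 0 ≤ bdryDistC p := Metric.infDist_nonneg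

lemma bdryDistC_le (p q : Completion X) : bdryDistC p ≤ bdryDistC q + dist p q :=
  Metric.infDist_le_infDist_add_dist

lemma continuous_bdryDistC : Continuous (bdryDistC (X := X)) :=
  Metric.continuous_infDist_pt _

lemma bdryDistC_boundary (z : MetricBoundary X) : bdryDistC (z : Completion X) = 0 :=
  Metric.infDist_zero_of_mem z.2

lemma kernel_comm (p q : Completion X) : kernel p q = kernel q p := by
  unfold kernel
  rw [dist_comm, mul_comm]

lemma kernel_nonneg (p q : Completion X) : 0 ≤ kernel p q := Real.sqrt_nonneg _

lemma kernel_le (p q : Completion X) :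
    kernel p q ≤ bdryDistC p + bdryDistC q + dist p q := by
  have hp := bdryDistC_nonneg p
  have hq := bdryDistC_nonneg q
  have hd : 0 ≤ dist p q := dist_nonneg
  refine Real.sqrt_le_iff.2 ⟨by positivity, ?_⟩
  nlinarith [mul_nonneg hp hq, mul_nonneg hp hd, mul_nonneg hq hd]

lemma le_two_mul_kernel (p q : Completion X) :
    bdryDistC p + bdryDistC q + dist p q ≤ 2 * kernel p q := by
  have hp := bdryDistC_nonneg p
  have hq := bdryDistC_nonneg q
  have hd : 0 ≤ dist p q := dist_nonneg
  have hpq := bdryDistC_le p q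
  have hqp := bdryDistC_le q p
  rw [dist_comm q p] at hqp
  have : (bdryDistC p + bdryDistC q + dist p q) / 2 ≤ kernel p q := by
    refine Real.le_sqrt_of_sq_le ?_
    have h1 : (bdryDistC p + bdryDistC q + dist p q) / 2 ≤ bdryDistC p + dist p q := by linarith
    have h2 : (bdryDistC p + bdryDistC q + dist p q) / 2 ≤ bdryDistC q + dist p q := by linarith
    rw [sq]
    exact mul_le_mul h1 h2 (by positivity) (by positivity)
  linarith

lemma dist_le_kernel (p q : Completion X) : dist p q ≤ kernel p q := by
  have hp := bdryDistC_nonneg p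
  have hq := bdryDistC_nonneg q
  have hd : 0 ≤ dist p q := dist_nonneg
  refine Real.le_sqrt_of_sq_le ?_
  rw [sq]
  exact mul_le_mul (by linarith) (by linarith) hd (by positivity)

lemma bdryDistC_le_kernel (p q : Completion X) : bdryDistC p ≤ 2 * kernel p q := by
  have := le_two_mul_kernel p q
  have := bdryDistC_nonneg q
  have : 0 ≤ dist p q := dist_nonneg
  linarith

/-- The kernel satisfies the triangle inequality up to the factor `2`, because it is comparable to
`d(p) + d(q) + |p - q|`. -/
lemma kernel_triangle (p q r : Completion X) : kernel p r ≤ 2 * (kernel p q + kernel q r) := by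
  have h1 := kernel_le p r
  have h2 := le_two_mul_kernel p q
  have h3 := le_two_mul_kernel q r
  have h4 := dist_triangle p q r
  have := bdryDistC_nonneg q
  linarith

lemma kernel_boundary (z z' : MetricBoundary X) :
    kernel (z : Completion X) z' = dist z z' := by
  unfold kernel
  rw [bdryDistC_boundary, bdryDistC_boundary, zero_add]
  exact Real.sqrt_mul_self dist_nonneg

variable (hd : ∀ x : X, 0 < bdryDist x)
include hd

lemma kernel_coe_pos (p : Completion X) (x : X) : 0 < kernel p x := by
  have := bdryDistC_le_kernel (x : Completion X) p
  rw [kernel_comm] at this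
  have h : 0 < bdryDistC (x : Completion X) := hd x
  linarith

lemma jTilde_eq (x y : X) :
    jTilde X x y = Real.log (kernel (x : Completion X) y) - Real.log (bdryDist x) / 2
      - Real.log (bdryDist y) / 2 := by
  have hx := hd x
  have hy := hd y
  have hxy : 0 ≤ dist x y := dist_nonneg
  have h : kernel (x : Completion X) y = √((bdryDist x + dist x y) * (bdryDist y + dist x y)) := by
    unfold kernel
    rw [Completion.dist_eq]
    rfl
  rw [h, Real.log_sqrt (by positivity), jTilde]
  have : (1 + dist x y / bdryDist x) * (1 + dist x y / bdryDist y)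
      = ((bdryDist x + dist x y) * (bdryDist y + dist x y)) / (bdryDist x * bdryDist y) := by
    field_simp
  rw [this, Real.log_div (by positivity) (by positivity), Real.log_mul hx.ne' hy.ne']
  ring

lemma gromovProd_jTilde (w x y : X) :
    gromovProd (jTilde X) w x y = (Real.log (kernel (x : Completion X) w)
      + Real.log (kernel (y : Completion X) w) - Real.log (kernel (x : Completion X) y)
      - Real.log (bdryDist w)) / 2 := by
  unfold gromovProd
  rw [jTilde_eq hd, jTilde_eq hd, jTilde_eq hd]
  ring

/-- The triangle inequality for the nonsymmetric function `log (1 + |x - y| / d(x))`, of which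
`j̃` is the symmetrization; it uses `d(y) ≤ d(x) + |x - y|`. -/
lemma one_add_dist_div_le (x y z : X) :
    1 + dist x z / bdryDist x ≤ (1 + dist x y / bdryDist x) * (1 + dist y z / bdryDist y) := by
  have hx := hd x
  have hy := hd y
  have h1 : bdryDist y ≤ bdryDist x + dist x y := by
    have := bdryDistC_le (y : Completion X) x
    rwa [Completion.dist_eq, dist_comm] at this
  have h2 := dist_triangle x y z
  have hyz : 0 ≤ dist y z := dist_nonneg
  have h3 : dist y z ≤ (bdryDist x + dist x y) * (dist y z / bdryDist y) := by
    rw [mul_div_assoc', le_div_iff₀ hy, mul_comm]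
    gcongr
  have h4 : (1 + dist x y / bdryDist x) * (1 + dist y z / bdryDist y)
      = (bdryDist x + dist x y + (bdryDist x + dist x y) * (dist y z / bdryDist y))
        / bdryDist x := by
    field_simp
  rw [h4, le_div_iff₀ hx, add_mul, div_mul_cancel₀ _ hx.ne']
  linarith

lemma half_log_le_jTilde (x y : X) :
    (1 / 2) * Real.log (1 + dist x y / bdryDist x) ≤ jTilde X x y := by
  have h1 : 0 ≤ dist x y / bdryDist x := div_nonneg dist_nonneg (hd x).le
  have h2 : 0 ≤ dist x y / bdryDist y := div_nonneg dist_nonneg (hd y).le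
  unfold jTilde
  gcongr
  exact le_mul_of_one_le_right (by positivity) (by linarith)

lemma isMetric_jTilde : IsMetric (jTilde X) where
  eq_zero_iff x y := by
    refine ⟨fun h => ?_, ?_⟩
    · by_contra hne
      have h1 : 0 < dist x y / bdryDist x := div_pos (dist_pos.2 hne) (hd x)
      have h2 := half_log_le_jTilde hd x y
      have h3 := Real.log_pos (show 1 < 1 + dist x y / bdryDist x by linarith)
      linarith
    · rintro rfl
      simp [jTilde]
  symm x y := by
    unfold jTilde
    rw [dist_comm, mul_comm (1 + dist y x / bdryDist x)]
  triangle x y z := by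
    have hp : ∀ a b : X, 0 < 1 + dist a b / bdryDist a := fun a b => by
      have := div_nonneg (dist_nonneg (x := a) (y := b)) (hd a).le
      linarith
    have key : ∀ a b : X, jTilde X a b = (1 / 2) * (Real.log (1 + dist a b / bdryDist a)
        + Real.log (1 + dist b a / bdryDist b)) := fun a b => by
      unfold jTilde
      rw [dist_comm b a, Real.log_mul (hp a b).ne']
      rw [dist_comm a b]
      exact (hp b a).ne'
    have h : ∀ a b c : X, Real.log (1 + dist a c / bdryDist a) ≤
        Real.log (1 + dist a b / bdryDist a) + Real.log (1 + dist b c / bdryDist b) :=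
      fun a b c => by
        rw [← Real.log_mul (hp a b).ne' (hp b c).ne']
        exact Real.log_le_log (hp a c) (one_add_dist_div_le hd a b c)
    have h1 := h x y z
    have h2 := h z y x
    rw [key, key, key]
    linarith

end Kernel

section Hyperbolic

variable {X : Type*} [MetricSpace X]

/-- The four-point inequality for the kernel. The smallest of the four kernels on the right-hand
side is absorbed, in each factor on the left, by a larger one. -/
lemma kernel_four_point (x y z w : Completion X) :
    kernel x y * kernel z w ≤
      16 * max (kernel x z * kernel y w) (kernel z y * kernel x w) := by
  have hn := kernel_nonneg (X := X)
  have h1 : ∀ {a b c d : ℝ}, 0 ≤ a → 0 ≤ d → a ≤ 4 * c → b ≤ 4 * d → a * b ≤ 16 * (c * d) := by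
    intro a b c d ha hd' hac hbd
    calc a * b ≤ a * (4 * d) := by gcongr
      _ ≤ (4 * c) * (4 * d) := by gcongr
      _ = 16 * (c * d) := by ring
  have t1 := kernel_triangle x z y
  have t2 := kernel_triangle x w y
  have t3 := kernel_triangle z x w
  have t4 := kernel_triangle z y w
  rw [kernel_comm w y] at t2
  rw [kernel_comm z x] at t3
  rcases le_total (kernel x z) (kernel y w) with hab | hab <;>
  rcases le_total (kernel z y) (kernel x w) with hcd | hcd <;>
  rcases le_total (min (kernel x z) (kernel y w)) (min (kernel z y) (kernel x w)) with h | h <;>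
  simp only [min_eq_left, min_eq_right, hab, hcd] at h
  all_goals first
    | exact (h1 (hn x y) (hn x w) (c := kernel z y) (by linarith) (by linarith)).trans
        (by gcongr; exact le_max_right _ _)
    | exact (h1 (hn x y) (hn z y) (c := kernel x w) (by linarith) (by linarith)).trans
        (by rw [mul_comm (kernel x w)]; gcongr; exact le_max_right _ _)
    | exact (h1 (hn x y) (hn y w) (c := kernel x z) (by linarith) (by linarith)).trans
        (by gcongr; exact le_max_left _ _)
    | exact (h1 (hn x y) (hn x z) (c := kernel y w) (by linarith) (by linarith)).trans
        (by rw [mul_comm (kernel y w)]; gcongr; exact le_max_left _ _)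

lemma isGromovHyperbolic_jTilde (hd : ∀ x : X, 0 < bdryDist x) :
    IsGromovHyperbolic (jTilde X) (Real.log 16 / 2) := by
  refine ⟨by have := Real.log_nonneg (show (1 : ℝ) ≤ 16 by norm_num); linarith,
    fun x y z w => ?_⟩
  have hp : ∀ a b : X, 0 < kernel (a : Completion X) b := fun a b => kernel_coe_pos hd a b
  have h16 : (0 : ℝ) < 16 := by norm_num
  have h4 := kernel_four_point (x : Completion X) y z w
  simp only [gromovProd_jTilde hd]
  rcases le_total (kernel (x : Completion X) z * kernel (y : Completion X) w)
    (kernel (z : Completion X) y * kernel (x : Completion X) w) with h | h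
  · rw [max_eq_right h] at h4
    have h5 := Real.log_le_log (mul_pos (hp x y) (hp z w)) h4
    rw [Real.log_mul (hp x y).ne' (hp z w).ne', Real.log_mul h16.ne'
      (mul_pos (hp z y) (hp x w)).ne', Real.log_mul (hp z y).ne' (hp x w).ne'] at h5
    rw [sub_le_iff_le_add]
    refine (min_le_right _ _).trans ?_
    linarith
  · rw [max_eq_left h] at h4
    have h5 := Real.log_le_log (mul_pos (hp x y) (hp z w)) h4
    rw [Real.log_mul (hp x y).ne' (hp z w).ne', Real.log_mul h16.ne'
      (mul_pos (hp x z) (hp y w)).ne', Real.log_mul (hp x z).ne' (hp y w).ne'] at h5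
    rw [sub_le_iff_le_add]
    refine (min_le_left _ _).trans ?_
    linarith

end Hyperbolic

/-! ### Limits of Gromov products at the ends of `X` -/

section Limits

variable {X : Type*} [MetricSpace X]

/-- The filter on `X` of sequences converging to a point of the completion (`some p`) or going to
infinity (`none`). -/
def endFilter : Option (Completion X) → Filter X
  | some p => Filter.comap (↑) (𝓝 p)
  | none => Bornology.cobounded X

/-- The value at a pair of points of `X̄ ∪ {∞}` of the continuous extension of the Gromov product
`(x|y)_w` of `j̃`. -/
def gromovLim (w : X) : Option (Completion X) → Option (Completion X) → EReal
  | some p, some q => open Classical in if kernel p q = 0 then ⊤ else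
      (((Real.log (kernel p w) + Real.log (kernel q w) - Real.log (kernel p q)
        - Real.log (bdryDist w)) / 2 : ℝ) : EReal)
  | some p, none => (((Real.log (kernel p w) - Real.log (bdryDist w)) / 2 : ℝ) : EReal)
  | none, some q => (((Real.log (kernel q w) - Real.log (bdryDist w)) / 2 : ℝ) : EReal)
  | none, none => ⊤

lemma pure_le_endFilter (x : X) : pure x ≤ endFilter (some (x : Completion X)) :=
  map_le_iff_le_comap.1 (by rw [map_pure]; exact pure_le_nhds _)

lemma tendsto_coe_endFilter (p : Completion X) :
    Tendsto (fun x : X => (x : Completion X)) (endFilter (some p)) (𝓝 p) :=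
  tendsto_comap

lemma tendsto_kernel {α : Type*} {l : Filter α} {f g : α → Completion X} {p q : Completion X}
    (hf : Tendsto f l (𝓝 p)) (hg : Tendsto g l (𝓝 q)) :
    Tendsto (fun a => kernel (f a) (g a)) l (𝓝 (kernel p q)) := by
  have hc := continuous_bdryDistC (X := X)
  have h1 := (hc.tendsto p).comp hf
  have h2 := (hc.tendsto q).comp hg
  exact ((h1.add (hf.dist hg)).mul (h2.add (hf.dist hg))).sqrt

instance endFilter_isCountablyGenerated (p : Option (Completion X)) :
    (endFilter p).IsCountablyGenerated := by
  match p with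
  | some p => exact inferInstanceAs (Filter.comap _ _).IsCountablyGenerated
  | none =>
    rcases isEmpty_or_nonempty X with h | ⟨⟨w⟩⟩
    · rw [Subsingleton.elim (endFilter (none : Option (Completion X))) ⊥]
      infer_instance
    · change (Bornology.cobounded X).IsCountablyGenerated
      rw [← Metric.comap_dist_right_atTop w]
      infer_instance

lemma endFilter_neBot (hX : ¬ Bornology.IsBounded (Set.univ : Set X))
    (p : Option (Completion X)) : (endFilter p).NeBot := by
  match p with
  | some p =>
    exact Completion.isDenseInducing_coe.comap_nhds_neBot p
  | none =>
    refine ⟨fun h => hX ?_⟩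
    have h' : Bornology.cobounded X = ⊥ := h
    exact Bornology.isBounded_univ.2 (Bornology.cobounded_eq_bot_iff.1 h')

/-- Two functions that differ by a bounded amount, the first of which tends to infinity, have
logarithms whose difference tends to zero. -/
lemma tendsto_log_sub_log {α : Type*} {l : Filter α} {f g : α → ℝ} {C : ℝ}
    (hf : Tendsto f l atTop) (hfg : ∀ᶠ a in l, |g a - f a| ≤ C) :
    Tendsto (fun a => Real.log (g a) - Real.log (f a)) l (𝓝 0) := by
  have h1 : Tendsto (fun a => (g a - f a) / f a) l (𝓝 0) := by
    have h2 : Tendsto (fun a => C / f a) l (𝓝 0) := hf.const_div_atTop C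
    refine squeeze_zero_norm' ?_ h2
    filter_upwards [hfg, hf.eventually_gt_atTop 0] with a ha hpos
    rw [Real.norm_eq_abs, abs_div, abs_of_pos hpos]
    gcongr
  have h3 : Tendsto (fun a => Real.log (1 + (g a - f a) / f a)) l (𝓝 0) := by
    have := (h1.const_add 1).log (by norm_num)
    simpa using this
  refine h3.congr' ?_
  filter_upwards [hf.eventually_gt_atTop 0, hf.eventually_gt_atTop C, hfg] with a ha hC hfa
  have hg : 0 < g a := by linarith [neg_abs_le (g a - f a)]
  rw [← Real.log_div hg.ne' ha.ne']
  congr 1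
  field_simp
  ring

lemma tendsto_coe_dist_cobounded (w : X) :
    Tendsto (fun x : X => dist (x : Completion X) w) (endFilter none) atTop := by
  simp only [Completion.dist_eq]
  exact Metric.tendsto_dist_right_cobounded_atTop w

variable (hd : ∀ x : X, 0 < bdryDist x)
include hd

/-- The quotient `k(x, y) / k(x, w)` tends to `1` as `x` goes to infinity and `y` stays bounded.
This makes Busemann functions based at `∞` explicit. -/
lemma tendsto_log_kernel_sub (w : X) (q : Completion X) :
    Tendsto (fun a : X × X => Real.log (kernel (a.1 : Completion X) a.2)
      - Real.log (kernel (a.1 : Completion X) w)) (endFilter none ×ˢ endFilter (some q)) (𝓝 0) := by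
  set l : Filter (X × X) := endFilter none ×ˢ endFilter (some q)
  have hw : Tendsto (fun a : X × X => dist (a.1 : Completion X) w) l atTop :=
    (tendsto_coe_dist_cobounded w).comp tendsto_fst
  have hy : ∀ᶠ a in l, dist (a.2 : Completion X) w < dist q w + 1 := by
    have h1 : Tendsto (fun a : X × X => dist (a.2 : Completion X) w) l (𝓝 (dist q w)) :=
      Tendsto.dist ((tendsto_coe_endFilter q).comp tendsto_snd) tendsto_const_nhds
    exact h1.eventually_lt_const (by linarith)
  have t1 : Tendsto (fun a : X × X => Real.log (bdryDistC (a.1 : Completion X)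
      + dist (a.1 : Completion X) a.2) - Real.log (bdryDistC (a.1 : Completion X)
      + dist (a.1 : Completion X) w)) l (𝓝 0) := by
    refine tendsto_log_sub_log (C := dist q w + 1) (tendsto_atTop_mono (fun a => ?_) hw) ?_
    · linarith [bdryDistC_nonneg (a.1 : Completion X)]
    · filter_upwards [hy] with a ha
      have h1 := abs_dist_sub_le (a.2 : Completion X) w a.1
      rw [dist_comm _ (a.1 : Completion X), dist_comm _ (a.1 : Completion X)] at h1
      rw [add_sub_add_left_eq_sub]
      exact h1.trans ha.le
  have t2 : Tendsto (fun a : X × X => Real.log (bdryDistC (a.2 : Completion X)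
      + dist (a.1 : Completion X) a.2) - Real.log (bdryDistC (w : Completion X)
      + dist (a.1 : Completion X) w)) l (𝓝 0) := by
    refine tendsto_log_sub_log (C := 2 * (dist q w + 1)) (tendsto_atTop_mono (fun a => ?_) hw) ?_
    · linarith [bdryDistC_nonneg (w : Completion X)]
    · filter_upwards [hy] with a ha
      have h1 := abs_le.1 (abs_dist_sub_le (a.2 : Completion X) w a.1)
      rw [dist_comm _ (a.1 : Completion X), dist_comm _ (a.1 : Completion X)] at h1
      have h2 := bdryDistC_le (a.2 : Completion X) w
      have h3 := bdryDistC_le (w : Completion X) a.2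
      rw [dist_comm] at h3
      rw [abs_le]
      constructor <;> linarith
  have t3 := (t1.add t2).div_const 2
  rw [add_zero, zero_div] at t3
  refine t3.congr fun a => ?_
  have ha : 0 < bdryDistC (a.1 : Completion X) := hd a.1
  have hb : 0 < bdryDistC (a.2 : Completion X) := hd a.2
  have hc : 0 < bdryDistC (w : Completion X) := hd w
  have e1 : 0 ≤ dist (a.1 : Completion X) a.2 := dist_nonneg
  have e2 : 0 ≤ dist (a.1 : Completion X) w := dist_nonneg
  unfold kernel
  rw [Real.log_sqrt (by positivity), Real.log_sqrt (by positivity),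
    Real.log_mul (by positivity) (by positivity), Real.log_mul (by positivity) (by positivity)]
  ring

lemma tendsto_log_kernel (w : X) (p : Completion X) :
    Tendsto (fun x : X => Real.log (kernel (x : Completion X) w)) (endFilter (some p))
      (𝓝 (Real.log (kernel p w))) := by
  exact (tendsto_kernel (tendsto_coe_endFilter p) tendsto_const_nhds).log (kernel_coe_pos hd p w).ne'

lemma tendsto_gromovProd (w : X) (p q : Option (Completion X)) :
    Tendsto (fun a : X × X => ((gromovProd (jTilde X) w a.1 a.2 : ℝ) : EReal))
      (endFilter p ×ˢ endFilter q) (𝓝 (gromovLim w p q)) := by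
  have mixed : ∀ q : Completion X,
      Tendsto (fun a : X × X => gromovProd (jTilde X) w a.1 a.2)
        (endFilter none ×ˢ endFilter (some q))
        (𝓝 ((Real.log (kernel q w) - Real.log (bdryDist w)) / 2)) := fun q => by
    have h1 := tendsto_log_kernel_sub hd w q
    have h2 := (tendsto_log_kernel hd w q).comp
      (tendsto_snd (f := endFilter (none : Option (Completion X))))
    have h3 := ((h2.sub h1).sub_const (Real.log (bdryDist w))).div_const 2
    rw [sub_zero] at h3
    refine h3.congr fun a => ?_
    rw [gromovProd_jTilde hd]
    simp only [Function.comp]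
    ring
  match p, q with
  | some p, some q =>
    have hk : Tendsto (fun a : X × X => kernel (a.1 : Completion X) a.2)
        (endFilter (some p) ×ˢ endFilter (some q)) (𝓝 (kernel p q)) :=
      tendsto_kernel ((tendsto_coe_endFilter p).comp tendsto_fst)
        ((tendsto_coe_endFilter q).comp tendsto_snd)
    have h1 := (tendsto_log_kernel hd w p).comp
      (tendsto_fst (f := endFilter (some p)) (g := endFilter (some q)))
    have h2 := (tendsto_log_kernel hd w q).comp
      (tendsto_snd (f := endFilter (some p)) (g := endFilter (some q)))
    have h12 := h1.add h2
    simp only [gromovProd_jTilde hd, gromovLim]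
    split_ifs with h0
    · rw [h0] at hk
      have hk' : Tendsto (fun a : X × X => Real.log (kernel (a.1 : Completion X) a.2))
          (endFilter (some p) ×ˢ endFilter (some q)) atBot :=
        Real.tendsto_log_nhdsGT_zero.comp (tendsto_nhdsWithin_iff.2
          ⟨hk, Eventually.of_forall fun a => kernel_coe_pos hd _ _⟩)
      rw [EReal.tendsto_coe_nhds_top_iff]
      refine Tendsto.atTop_div_const two_pos (tendsto_atTop_add_const_right _ _ ?_)
      exact h12.add_atTop (tendsto_neg_atBot_atTop.comp hk')
    · exact (continuous_coe_real_ereal.tendsto _).comp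
        (((h12.sub (hk.log h0)).sub_const _).div_const 2)
  | none, some q => exact (continuous_coe_real_ereal.tendsto _).comp (mixed q)
  | some p, none =>
    have h := (continuous_coe_real_ereal.tendsto _).comp ((mixed p).comp
      (tendsto_snd.prodMk (tendsto_fst (f := endFilter (some p)) (g := endFilter none))))
    refine h.congr fun a => ?_
    simp only [Function.comp, gromovProd_jTilde hd, kernel_comm (a.2 : Completion X)]
    congr 2
    ring
  | none, none =>
    rw [gromovLim, EReal.tendsto_coe_nhds_top_iff]
    -- `k(x, y) ≤ 4 max (k(x, w)) (k(y, w))`, so the smaller kernel controls the product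
    have hw : Tendsto (fun x : X => Real.log (kernel (x : Completion X) w))
        (endFilter none) atTop :=
      Real.tendsto_log_atTop.comp (tendsto_atTop_mono (fun x => dist_le_kernel _ _)
        (tendsto_coe_dist_cobounded w))
    have h1 : Tendsto (fun a : X × X => min (Real.log (kernel (a.1 : Completion X) w))
        (Real.log (kernel (a.2 : Completion X) w)))
        (endFilter none ×ˢ endFilter none) atTop :=
      tendsto_atTop.2 fun b => by
        filter_upwards [(hw.comp tendsto_fst).eventually_ge_atTop b,
          (hw.comp tendsto_snd).eventually_ge_atTop b] with a h1 h2 using le_min h1 h2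
    refine tendsto_atTop_mono (fun a => ?_) ((tendsto_atTop_add_const_right _
      (-Real.log 4 - Real.log (bdryDist w)) h1).atTop_div_const two_pos)
    rw [gromovProd_jTilde hd]
    have p1 := kernel_coe_pos hd (a.1 : Completion X) w
    have p2 := kernel_coe_pos hd (a.2 : Completion X) w
    have p3 := kernel_coe_pos hd (a.1 : Completion X) a.2
    have h2 := kernel_triangle (a.1 : Completion X) w a.2
    rw [kernel_comm (w : Completion X)] at h2
    have h4 : (4 : ℝ) ≠ 0 := by norm_num
    rcases le_total (kernel (a.1 : Completion X) w) (kernel (a.2 : Completion X) w) with h | h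
    · have h3 := Real.log_le_log p3 (show kernel (a.1 : Completion X) a.2
        ≤ 4 * kernel (a.2 : Completion X) w by linarith)
      rw [Real.log_mul h4 p2.ne'] at h3
      have := min_le_left (Real.log (kernel (a.1 : Completion X) w))
        (Real.log (kernel (a.2 : Completion X) w))
      linarith
    · have h3 := Real.log_le_log p3 (show kernel (a.1 : Completion X) a.2
        ≤ 4 * kernel (a.1 : Completion X) w by linarith)
      rw [Real.log_mul h4 p1.ne'] at h3
      have := min_le_right (Real.log (kernel (a.1 : Completion X) w))
        (Real.log (kernel (a.2 : Completion X) w))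
      linarith

end Limits

/-! ### The boundary at infinity of `(X, j̃)` -/

section Boundary

variable {X : Type*} [MetricSpace X]

/-- A point of `∂X ∪ {∞}` as a point of `X̄ ∪ {∞}`. -/
abbrev endPoint (o : Option (MetricBoundary X)) : Option (Completion X) := o.map Subtype.val

lemma gromovLim_eq_top_iff (w : X) (o o' : Option (MetricBoundary X)) :
    gromovLim w (endPoint o) (endPoint o') = ⊤ ↔ o = o' := by
  match o, o' with
  | some z, some z' =>
    have h : kernel (z : Completion X) z' = 0 ↔ z = z' := by rw [kernel_boundary, dist_eq_zero]
    simp only [endPoint, Option.map_some, gromovLim, h, Option.some.injEq]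
    split_ifs with h0
    · simpa using h.1 h0
    · simpa using fun e => h0 (h.2 e)
  | some z, none => simp [gromovLim]
  | none, some z => simp [gromovLim]
  | none, none => simp [gromovLim]

variable (hd : ∀ x : X, 0 < bdryDist x)
include hd

/-- The Gromov products along sequences tending to the same point of `∂X ∪ {∞}` tend to
infinity. -/
lemma tendsto_gromovProd_atTop (w : X) (o : Option (MetricBoundary X)) :
    Tendsto (fun a : X × X => gromovProd (jTilde X) w a.1 a.2)
      (endFilter (endPoint o) ×ˢ endFilter (endPoint o)) atTop := by
  have h := tendsto_gromovProd hd w (endPoint o) (endPoint o)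
  rwa [(gromovLim_eq_top_iff w o o).2 rfl, EReal.tendsto_coe_nhds_top_iff] at h

lemma isGromovSeq_of_tendsto {x : ℕ → X} {o : Option (MetricBoundary X)}
    (hx : Tendsto x atTop (endFilter (endPoint o))) : IsGromovSeq (jTilde X) x := fun w => by
  rw [← prod_atTop_atTop_eq]
  have h := (tendsto_gromovProd_atTop hd w o).comp (hx.prodMap hx)
  exact h

lemma gromovEquiv_of_tendsto {x y : ℕ → X} {o : Option (MetricBoundary X)}
    (hx : Tendsto x atTop (endFilter (endPoint o))) (hy : Tendsto y atTop (endFilter (endPoint o))) :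
    GromovEquiv (jTilde X) x y := fun w => by
  have h := (tendsto_gromovProd_atTop hd w o).comp (hx.prodMk hy)
  exact h

lemma eq_of_gromovEquiv [Nonempty X] {x y : ℕ → X} {o o' : Option (MetricBoundary X)}
    (hx : Tendsto x atTop (endFilter (endPoint o)))
    (hy : Tendsto y atTop (endFilter (endPoint o')))
    (hxy : GromovEquiv (jTilde X) x y) : o = o' := by
  obtain ⟨w⟩ := ‹Nonempty X›
  have h1 := (tendsto_gromovProd hd w _ _).comp (hx.prodMk hy)
  have h2 : Tendsto (fun i => ((gromovProd (jTilde X) w (x i) (y i) : ℝ) : EReal)) atTop (𝓝 ⊤) :=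
    EReal.tendsto_coe_nhds_top_iff.2 (hxy w)
  exact (gromovLim_eq_top_iff w o o').1 (tendsto_nhds_unique h1 h2)

/-- If `y` stays at bounded distance from `w`, a large Gromov product `(x|y)_w` forces `k(x, y)` to
be small. -/
lemma exists_kernel_le_of_gromovProd (w : X) (M : ℝ) {e : ℝ} (he : 0 < e) :
    ∃ R : ℝ, ∀ x y : X, kernel (y : Completion X) w ≤ M → R < gromovProd (jTilde X) w x y →
      kernel (x : Completion X) y < e := by
  refine ⟨(Real.log (2 * (1 + M / e)) + Real.log M - Real.log (bdryDist w)) / 2,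
    fun x y hy hR => ?_⟩
  by_contra! hk
  have hyw := kernel_coe_pos hd (y : Completion X) w
  have hxw := kernel_coe_pos hd (x : Completion X) w
  have hxy := he.trans_le hk
  have hM := hyw.trans_le hy
  have h1 : kernel (x : Completion X) w ≤ kernel (x : Completion X) y * (2 * (1 + M / e)) := by
    have h2 := kernel_triangle (x : Completion X) y w
    have h3 : M ≤ kernel (x : Completion X) y * (M / e) := by
      rw [mul_div_assoc', le_div_iff₀ he, mul_comm]
      gcongr
    linarith
  have h2 := Real.log_le_log hxw h1
  rw [Real.log_mul hxy.ne' (by positivity)] at h2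
  have h3 := Real.log_le_log hyw hy
  rw [gromovProd_jTilde hd] at hR
  linarith

/-- A Gromov sequence tends to infinity or to a point of the metric boundary. -/
lemma exists_tendsto_of_isGromovSeq [Nonempty X] {x : ℕ → X} (hx : IsGromovSeq (jTilde X) x) :
    ∃ o : Option (MetricBoundary X), Tendsto x atTop (endFilter (endPoint o)) := by
  obtain ⟨w⟩ := ‹Nonempty X›
  by_cases hinf : Tendsto x atTop (Bornology.cobounded X)
  · exact ⟨none, hinf⟩
  -- otherwise a subsequence is bounded, and the whole sequence is Cauchy with `d(x_i) → 0`
  rw [← Metric.tendsto_dist_right_atTop_iff w, tendsto_atTop] at hinf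
  push Not at hinf
  obtain ⟨M, hM⟩ := hinf
  have small : ∀ e : ℝ, 0 < e → ∃ N k : ℕ, ∀ i ≥ N, kernel (x i : Completion X) (x k) < e := by
    intro e he
    obtain ⟨R, hR⟩ := exists_kernel_le_of_gromovProd hd w (2 * (bdryDist w + M)) he
    have h1 := (hx w).eventually_gt_atTop R
    obtain ⟨⟨N₁, N₂⟩, hN⟩ := eventually_atTop.1 h1
    set N := max N₁ N₂
    obtain ⟨k, hkN, hk⟩ := frequently_atTop.1 hM N
    refine ⟨N, k, fun i hi => hR _ _ ?_ (hN (i, k)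
      ⟨(le_max_left _ _).trans hi, (le_max_right _ _).trans hkN⟩)⟩
    have h2 := kernel_le (x k : Completion X) w
    have h3 := bdryDistC_le (x k : Completion X) w
    rw [Completion.dist_eq] at h2 h3
    have h4 : bdryDistC (w : Completion X) = bdryDist w := rfl
    linarith
  have hcauchy : CauchySeq fun i => (x i : Completion X) := by
    refine Metric.cauchySeq_iff.2 fun e he => ?_
    obtain ⟨N, k, h⟩ := small (e / 2) (by positivity)
    refine ⟨N, fun m hm n hn => ?_⟩
    have h1 := (dist_le_kernel _ _).trans_lt (h m hm)
    have h2 := (dist_le_kernel _ _).trans_lt (h n hn)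
    have h3 := dist_triangle_right (x m : Completion X) (x n) (x k)
    linarith
  obtain ⟨z, hz⟩ := cauchySeq_tendsto_of_complete hcauchy
  have hz0 : bdryDistC z = 0 := by
    refine le_antisymm (le_of_forall_pos_le_add fun e he => ?_) (bdryDistC_nonneg z)
    obtain ⟨N, k, h⟩ := small (e / 2) (by positivity)
    refine le_of_tendsto ((continuous_bdryDistC.tendsto z).comp hz) ?_
    filter_upwards [eventually_ge_atTop N] with i hi
    have h1 := bdryDistC_le_kernel (x i : Completion X) (x k)
    have h2 := h i hi
    simp only [Function.comp]
    linarith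
  refine ⟨some ⟨z, ?_⟩, tendsto_comap_iff.2 hz⟩
  rintro ⟨a, rfl⟩
  exact (hd a).ne' hz0

variable (hX : ¬ Bornology.IsBounded (Set.univ : Set X))

omit hd in
lemma nonempty_of_not_isBounded (hX : ¬ Bornology.IsBounded (Set.univ : Set X)) : Nonempty X := by
  by_contra h
  rw [not_nonempty_iff] at h
  exact hX (by simp [Set.univ_eq_empty_iff.2 h])

include hX

omit hd in
lemma exists_seq_tendsto_endFilter (p : Option (Completion X)) :
    ∃ x : ℕ → X, Tendsto x atTop (endFilter p) :=
  have := endFilter_neBot hX p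
  exists_seq_tendsto _

/-- The point of the boundary at infinity that corresponds to a point of `∂X ∪ {∞}`: the class of
all sequences tending to it. -/
def endClass (o : Option (MetricBoundary X)) : GromovBoundary (jTilde X) :=
  ⟨{x | Tendsto x atTop (endFilter (endPoint o))}, by
    have := nonempty_of_not_isBounded hX
    obtain ⟨x, hx⟩ := exists_seq_tendsto_endFilter hX (endPoint o)
    refine ⟨x, isGromovSeq_of_tendsto hd hx, Set.ext fun y => ⟨fun hy =>
      ⟨isGromovSeq_of_tendsto hd hy, gromovEquiv_of_tendsto hd hx hy⟩, fun ⟨hy, hxy⟩ => ?_⟩⟩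
    obtain ⟨o', hy'⟩ := exists_tendsto_of_isGromovSeq hd hy
    rwa [eq_of_gromovEquiv hd hx hy' hxy]⟩

lemma mem_seqs_endClass {o : Option (MetricBoundary X)} {x : ℕ → X} :
    x ∈ (endClass hd hX o).seqs ↔ Tendsto x atTop (endFilter (endPoint o)) := Iff.rfl

lemma endClass_bijective : Function.Bijective (endClass hd hX) := by
  have := nonempty_of_not_isBounded hX
  refine ⟨fun o o' h => ?_, fun ζ => ?_⟩
  · obtain ⟨x, hx⟩ := exists_seq_tendsto_endFilter hX (endPoint o)
    have hx' : x ∈ (endClass hd hX o').seqs := h ▸ (mem_seqs_endClass hd hX).2 hx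
    exact eq_of_gromovEquiv hd hx hx' (gromovEquiv_of_tendsto hd hx hx)
  · obtain ⟨A, x, hx, hA⟩ := ζ
    obtain ⟨o, ho⟩ := exists_tendsto_of_isGromovSeq hd hx
    refine ⟨o, Subtype.ext (Eq.trans ?_ hA.symm)⟩
    refine Set.ext fun y => ⟨fun hy =>
      ⟨isGromovSeq_of_tendsto hd hy, gromovEquiv_of_tendsto hd ho hy⟩, fun ⟨hy, hxy⟩ => ?_⟩
    obtain ⟨o', hy'⟩ := exists_tendsto_of_isGromovSeq hd hy
    have := eq_of_gromovEquiv hd ho hy' hxy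
    subst this
    exact hy'

/-- The boundary at infinity of `(X, j̃)` is `∂X ∪ {∞}`. -/
def endEquiv : Option (MetricBoundary X) ≃ GromovBoundary (jTilde X) :=
  Equiv.ofBijective _ (endClass_bijective hd hX)

lemma mem_seqs_endEquiv {o : Option (MetricBoundary X)} {x : ℕ → X} :
    x ∈ (endEquiv hd hX o).seqs ↔ Tendsto x atTop (endFilter (endPoint o)) := Iff.rfl

/-- If a function of two points converges along the ends `o` and `o'`, then the infimum of the
lower limits along all pairs of representing sequences is the limit. -/
lemma iInf_liminf_seqs_eq {f : X → X → ℝ} {L : EReal} {o o' : Option (MetricBoundary X)}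
    (h : Tendsto (fun a : X × X => ((f a.1 a.2 : ℝ) : EReal))
      (endFilter (endPoint o) ×ˢ endFilter (endPoint o')) (𝓝 L)) :
    ⨅ x ∈ (endEquiv hd hX o).seqs, ⨅ y ∈ (endEquiv hd hX o').seqs,
      liminf (fun i : ℕ => ((f (x i) (y i) : ℝ) : EReal)) atTop = L := by
  have h1 : ∀ x ∈ (endEquiv hd hX o).seqs, ⨅ y ∈ (endEquiv hd hX o').seqs,
      liminf (fun i : ℕ => ((f (x i) (y i) : ℝ) : EReal)) atTop = L := fun x hx => by
    rw [← biInf_const (a := L) (exists_seq_tendsto_endFilter hX (endPoint o'))]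
    exact biInf_congr fun y hy => (h.comp
      (((mem_seqs_endEquiv hd hX).1 hx).prodMk ((mem_seqs_endEquiv hd hX).1 hy))).liminf_eq
  rw [biInf_congr h1]
  exact biInf_const (exists_seq_tendsto_endFilter hX (endPoint o))

lemma gromovProdBdry_endEquiv (w : X) (o o' : Option (MetricBoundary X)) :
    gromovProdBdry (jTilde X) w (endEquiv hd hX o) (endEquiv hd hX o')
      = gromovLim w (endPoint o) (endPoint o') :=
  iInf_liminf_seqs_eq hd hX (tendsto_gromovProd hd w _ _)

lemma gromovProdPt_endEquiv (w a : X) (o : Option (MetricBoundary X)) :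
    gromovProdPt (jTilde X) w a (endEquiv hd hX o)
      = gromovLim w (some (a : Completion X)) (endPoint o) := by
  rw [← biInf_const (a := gromovLim w (some (a : Completion X)) (endPoint o))
    (exists_seq_tendsto_endFilter hX (endPoint o))]
  refine biInf_congr fun y hy => ?_
  have ha : Tendsto (fun _ : ℕ => a) atTop (endFilter (some (a : Completion X))) :=
    tendsto_const_pure.mono_right (pure_le_endFilter a)
  exact ((tendsto_gromovProd hd w _ _).comp
    (ha.prodMk ((mem_seqs_endEquiv hd hX).1 hy))).liminf_eq

end Boundary

/-! ### The natural map -/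

section NaturalMap

variable {X : Type*} [MetricSpace X]

lemma exists_dist_lt_of_jTilde_lt (hd : ∀ x : X, 0 < bdryDist x) (x : X) {r : ℝ} (hr : 0 < r) :
    ∃ s : ℝ, 0 < s ∧ ∀ y : X, jTilde X x y < s → dist x y < r := by
  have h1 : 0 < r / bdryDist x := div_pos hr (hd x)
  refine ⟨(1 / 2) * Real.log (1 + r / bdryDist x),
    mul_pos (by norm_num) (Real.log_pos (by linarith)), fun y hy => ?_⟩
  by_contra! h
  refine (hy.trans_le ?_).not_ge (half_log_le_jTilde hd x y)
  have := (hd x).le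
  gcongr

/-- Large extended Gromov products with a point `o` of `∂X ∪ {∞}` force a point of `X̄ ∪ {∞}` into
a given neighbourhood of `o`. This is the continuity of the natural map at the boundary. -/
lemma exists_gromovLim_lt_imp_mem (hd : ∀ x : X, 0 < bdryDist x) (w : X)
    {U : Set (MetricExt (Completion X))} (hU : IsOpen U) (o : Option (MetricBoundary X))
    (ho : endPoint o ∈ U) :
    ∃ R : ℝ, ∀ p : Option (Completion X), (R : EReal) < gromovLim w p (endPoint o) → p ∈ U := by
  match o, ho with
  | none, ho =>
    obtain ⟨r, hr⟩ := (hU.2 ho).subset_closedBall (w : Completion X)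
    refine ⟨(Real.log (2 * (bdryDist w + r)) - Real.log (bdryDist w)) / 2, fun p hp => ?_⟩
    match p, hp with
    | none, _ => exact ho
    | some p, hp =>
      by_contra hpU
      have h1 : dist p (w : Completion X) ≤ r := hr hpU
      have h2 := kernel_le p w
      have h3 := bdryDistC_le p w
      have h4 : bdryDistC (w : Completion X) = bdryDist w := rfl
      have h5 := Real.log_le_log (kernel_coe_pos hd p w)
        (show kernel p w ≤ 2 * (bdryDist w + r) by linarith)
      simp only [endPoint, Option.map_none, gromovLim, EReal.coe_lt_coe_iff] at hp
      linarith
  | some z, ho =>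
    obtain ⟨r, hr, hrU⟩ := Metric.isOpen_iff.1 hU.1 z ho
    set A := Real.log (kernel (z : Completion X) w) - Real.log (bdryDist w)
    set B := Real.log (2 * (1 + kernel (z : Completion X) w / r))
    refine ⟨max (A / 2) ((A + B) / 2), fun p hp => ?_⟩
    match p, hp with
    | none, hp =>
      have h1 : ((A / 2 : ℝ) : EReal) < (A / 2 : ℝ) :=
        lt_of_le_of_lt (EReal.coe_le_coe_iff.2 (le_max_left _ _)) hp
      exact absurd h1 (lt_irrefl _)
    | some p, hp =>
      by_contra hpU
      have hpz : r ≤ dist p (z : Completion X) := by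
        by_contra! h
        exact hpU (hrU h)
      have hk := hpz.trans (dist_le_kernel _ _)
      have hk0 := hr.trans_le hk
      have hz := kernel_coe_pos hd (z : Completion X) w
      have h1 : kernel p w ≤ kernel p z * (2 * (1 + kernel (z : Completion X) w / r)) := by
        have h2 := kernel_triangle p z w
        have h3 : kernel (z : Completion X) w ≤ kernel p z * (kernel (z : Completion X) w / r) := by
          rw [mul_div_assoc', le_div_iff₀ hr, mul_comm]
          gcongr
        linarith
      have h2 := Real.log_le_log (kernel_coe_pos hd p w) h1
      rw [Real.log_mul hk0.ne' (by positivity)] at h2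
      simp only [endPoint, Option.map_some, gromovLim, if_neg hk0.ne'] at hp
      have h3 := EReal.coe_lt_coe_iff.1
        (lt_of_le_of_lt (EReal.coe_le_coe_iff.2 (le_max_right _ _)) hp)
      linarith

variable (hd : ∀ x : X, 0 < bdryDist x) (hX : ¬ Bornology.IsBounded (Set.univ : Set X))

/-- The natural map: the identity on `X`, and on the boundary at infinity the identification with
`∂X ∪ {∞}`. -/
def naturalMap : GromovClosure (jTilde X) → MetricExt (Completion X) :=
  Sum.elim (fun x => MetricExt.pt (x : Completion X))
    fun ζ => endPoint ((endEquiv hd hX).symm ζ)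

lemma naturalMap_endEquiv (o : Option (MetricBoundary X)) :
    naturalMap hd hX (GromovClosure.bdry (endEquiv hd hX o)) = endPoint o :=
  congrArg endPoint ((endEquiv hd hX).symm_apply_apply o)

lemma continuous_naturalMap : Continuous (naturalMap hd hX) := by
  refine ⟨fun U hU => ⟨fun x hx => ?_, fun ζ hζ w => ?_⟩⟩
  · obtain ⟨r, hr, hrU⟩ := Metric.isOpen_iff.1 hU.1 (x : Completion X) hx
    obtain ⟨s, hs, h⟩ := exists_dist_lt_of_jTilde_lt hd x hr
    refine ⟨s, hs, fun y hy => hrU ?_⟩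
    rw [Metric.mem_ball, Completion.dist_eq, dist_comm]
    exact h y hy
  · obtain ⟨o, rfl⟩ := (endEquiv hd hX).surjective ζ
    have ho : endPoint o ∈ U := naturalMap_endEquiv hd hX o ▸ hζ
    obtain ⟨R, hR⟩ := exists_gromovLim_lt_imp_mem hd w hU o ho
    refine ⟨R, fun y hy => hR (some (y : Completion X)) ?_, fun ζ' hζ' => ?_⟩
    · rwa [gromovProdPt_endEquiv] at hy
    · obtain ⟨o', rfl⟩ := (endEquiv hd hX).surjective ζ'
      rw [gromovProdBdry_endEquiv] at hζ'
      rw [Set.mem_preimage, naturalMap_endEquiv]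
      exact hR _ hζ'

lemma isNaturalMap_naturalMap : IsNaturalMap (naturalMap hd hX) where
  continuous := continuous_naturalMap hd hX
  extends_id _ := rfl
  maps_boundary ζ := by
    obtain ⟨o, rfl⟩ := (endEquiv hd hX).surjective ζ
    rw [naturalMap_endEquiv]
    match o with
    | none => exact Or.inl rfl
    | some z => exact Or.inr ⟨z, rfl⟩

end NaturalMap

/-! ### Chain metrics -/

section Chain

variable {A : Type*}

/-- The infimum of the sums of `ρ` along finite chains from `x` to `y`. -/
def chainInf (ρ : A → A → ℝ) (x y : A) : ℝ :=
  sInf {s : ℝ | ∃ (n : ℕ) (c : ℕ → A), 1 ≤ n ∧ c 0 = x ∧ c n = y ∧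
    s = ∑ i ∈ Finset.range n, ρ (c i) (c (i + 1))}

/-- Frink's chain lemma: sums of a `K`-quasi-ultrametric along chains bound half the value at
the end points, if `K² ≤ 2`. -/
lemma le_two_mul_sum_chain {ρ : A → A → ℝ} (h0 : ∀ x y, 0 ≤ ρ x y) (hself : ∀ x, ρ x x = 0)
    (hsymm : ∀ x y, ρ x y = ρ y x) {K : ℝ} (hK1 : 1 ≤ K) (hK2 : K * K ≤ 2)
    (hK : ∀ x y z, ρ x y ≤ K * max (ρ x z) (ρ z y)) (n : ℕ) (c : ℕ → A) :
    ρ (c 0) (c n) ≤ 2 * ∑ i ∈ Finset.range n, ρ (c i) (c (i + 1)) := by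
  let d : A → A → ℝ≥0 := fun x y => ⟨ρ x y, h0 x y⟩
  have dself : ∀ x, d x x = 0 := fun x => NNReal.eq (hself x)
  have dsymm : ∀ x y, d x y = d y x := fun x y => NNReal.eq (hsymm x y)
  let := PseudoMetricSpace.ofPreNNDist d dself dsymm
  have hd : ∀ x y, ρ x y ≤ 2 * dist x y := fun x y => by
    refine PseudoMetricSpace.le_two_mul_dist_ofPreNNDist d dself dsymm (fun x₁ x₂ x₃ x₄ => ?_) x y
    rw [← NNReal.coe_le_coe]
    push_cast
    change ρ x₁ x₄ ≤ 2 * max (ρ x₁ x₂) (max (ρ x₂ x₃) (ρ x₃ x₄))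
    set m := max (ρ x₁ x₂) (max (ρ x₂ x₃) (ρ x₃ x₄))
    have hm : 0 ≤ m := (h0 _ _).trans (le_max_left _ _)
    have h1 : ρ x₂ x₄ ≤ K * m :=
      (hK x₂ x₄ x₃).trans (by gcongr; exact le_max_right _ _)
    have h2 : ρ x₁ x₂ ≤ K * m :=
      (le_max_left _ _).trans (le_mul_of_one_le_left hm hK1)
    calc ρ x₁ x₄ ≤ K * max (ρ x₁ x₂) (ρ x₂ x₄) := hK _ _ _
      _ ≤ K * (K * m) := by gcongr; exact max_le h2 h1
      _ = K * K * m := by ring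
      _ ≤ 2 * m := by gcongr
  have hle : ∀ x y, dist x y ≤ ρ x y := fun x y =>
    PseudoMetricSpace.dist_ofPreNNDist_le d dself dsymm x y
  refine (hd _ _).trans ?_
  gcongr
  exact (dist_le_range_sum_dist c n).trans (Finset.sum_le_sum fun i _ => hle _ _)

variable {ρ : A → A → ℝ}

lemma chainInf_le_sum (h0 : ∀ x y, 0 ≤ ρ x y) {n : ℕ} (hn : 1 ≤ n) (c : ℕ → A) :
    chainInf ρ (c 0) (c n) ≤ ∑ i ∈ Finset.range n, ρ (c i) (c (i + 1)) := by
  refine csInf_le ⟨0, ?_⟩ ⟨n, c, hn, rfl, rfl, rfl⟩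
  rintro s ⟨n, c, -, -, -, rfl⟩
  exact Finset.sum_nonneg fun i _ => h0 _ _

lemma le_chainInf {x y : A} {r : ℝ} (h : ∀ (n : ℕ) (c : ℕ → A), 1 ≤ n → c 0 = x → c n = y →
    r ≤ ∑ i ∈ Finset.range n, ρ (c i) (c (i + 1))) : r ≤ chainInf ρ x y := by
  refine le_csInf ⟨_, 1, fun i => if i = 0 then x else y, le_rfl, rfl, rfl, rfl⟩ ?_
  rintro s ⟨n, c, hn, h0, h1, rfl⟩
  exact h n c hn h0 h1

lemma chainInf_le (h0 : ∀ x y, 0 ≤ ρ x y) (x y : A) : chainInf ρ x y ≤ ρ x y := by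
  simpa using chainInf_le_sum h0 le_rfl fun i => if i = 0 then x else y

lemma chainInf_comm_le (h0 : ∀ x y, 0 ≤ ρ x y) (hsymm : ∀ x y, ρ x y = ρ y x) (x y : A) :
    chainInf ρ x y ≤ chainInf ρ y x := by
  refine le_chainInf fun n c hn hx hy => ?_
  have h := chainInf_le_sum h0 hn fun i => c (n - i)
  simp only [Nat.sub_zero, Nat.sub_self, hx, hy] at h
  refine h.trans_eq ?_
  rw [← Finset.sum_range_reflect]
  refine Finset.sum_congr rfl fun i hi => ?_
  rw [Finset.mem_range] at hi
  rw [hsymm]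
  congr 2 <;> omega

lemma chainInf_triangle (h0 : ∀ x y, 0 ≤ ρ x y) (x y z : A) :
    chainInf ρ x z ≤ chainInf ρ x y + chainInf ρ y z := by
  rw [← sub_le_iff_le_add]
  refine le_chainInf fun n c hn hx hy => ?_
  rw [sub_le_comm]
  refine le_chainInf fun m c' hm hy' hz => ?_
  rw [sub_le_iff_le_add']
  have h := chainInf_le_sum h0 (show 1 ≤ n + m by omega)
    fun i => if i ≤ n then c i else c' (i - n)
  have hend : (if n + m ≤ n then c (n + m) else c' (n + m - n)) = z := by
    rw [if_neg (by omega), Nat.add_sub_cancel_left, hz]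
  simp only [Nat.zero_le, if_true, hx, hend] at h
  refine h.trans_eq ?_
  rw [Finset.sum_range_add]
  congr 1
  · refine Finset.sum_congr rfl fun i hi => ?_
    rw [Finset.mem_range] at hi
    rw [if_pos (by omega), if_pos (by omega)]
  · refine Finset.sum_congr rfl fun i _ => ?_
    rw [if_neg (show ¬ n + i + 1 ≤ n by omega), show n + i + 1 - n = i + 1 by omega]
    split_ifs with hi
    · obtain rfl : i = 0 := by omega
      rw [Nat.add_zero, hy, hy']
    · rw [Nat.add_sub_cancel_left]

lemma isMetric_chainInf (h0 : ∀ x y, 0 ≤ ρ x y) (hzero : ∀ x y, ρ x y = 0 ↔ x = y)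
    (hsymm : ∀ x y, ρ x y = ρ y x) (hle : ∀ x y, ρ x y ≤ 2 * chainInf ρ x y) :
    IsMetric (chainInf ρ) where
  eq_zero_iff x y := by
    rw [← hzero]
    have h1 := chainInf_le h0 x y
    have h2 := hle x y
    have h3 := h0 x y
    constructor <;> intro h <;> linarith
  symm x y := le_antisymm (chainInf_comm_le h0 hsymm x y) (chainInf_comm_le h0 hsymm y x)
  triangle := chainInf_triangle h0

end Chain

/-! ### Maps that are bi-Lipschitz up to a snowflake transformation -/

section Snowflake

/-- The homeomorphism `t ↦ (2 t) ^ r` of `[0, ∞)`. -/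
def powerHomeo (r : ℝ) (hr : 0 < r) : ℝ≥0 ≃ₜ ℝ≥0 :=
  (Homeomorph.mulLeft₀ (2 : ℝ≥0) two_ne_zero).trans (NNReal.orderIsoRpow r hr).toHomeomorph

lemma coe_powerHomeo (r : ℝ) (hr : 0 < r) (t : ℝ≥0) :
    (powerHomeo r hr t : ℝ) = (2 * t : ℝ) ^ r := by
  change (((2 * t) ^ r : ℝ≥0) : ℝ) = _
  push_cast
  rfl

variable {A B : Type*} [MetricSpace A] [MetricSpace B] {e : A ≃ B} {c s : ℝ}

omit [MetricSpace A] in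
lemma dist_le_of_snowflake (hc : 0 < c) (hs : 0 < s) {x y : A} {r : ℝ}
    (h : (dist (e x) (e y) / c) ^ s ≤ r) : dist (e x) (e y) ≤ c * r ^ (1 / s) := by
  have h0 : 0 ≤ dist (e x) (e y) / c := by positivity
  have h1 := Real.rpow_le_rpow (by positivity) h (show 0 ≤ 1 / s by positivity)
  rw [← Real.rpow_mul h0, mul_one_div_cancel hs.ne', Real.rpow_one, div_le_iff₀ hc] at h1
  linarith

/-- A bijection that is bi-Lipschitz up to a power of the metric is a homeomorphism. -/
def snowflakeHomeo (e : A ≃ B) (hc : 0 < c) (hs : 0 < s)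
    (h1 : ∀ x y, dist x y ≤ (dist (e x) (e y) / c) ^ s)
    (h2 : ∀ x y, (dist (e x) (e y) / c) ^ s ≤ 2 * dist x y) : A ≃ₜ B where
  toEquiv := e
  continuous_toFun := by
    refine continuous_iff_continuousAt.2 fun x => tendsto_iff_dist_tendsto_zero.2 ?_
    refine squeeze_zero (fun _ => dist_nonneg)
      (fun y => dist_le_of_snowflake hc hs (h2 y x)) ?_
    have h : Continuous fun y => c * (2 * dist y x) ^ (1 / s) :=
      continuous_const.mul ((continuous_const.mul (continuous_id.dist continuous_const)).rpow_const
        fun _ => Or.inr (by positivity))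
    have := h.tendsto x
    rwa [dist_self, mul_zero, Real.zero_rpow (by positivity), mul_zero] at this
  continuous_invFun := by
    refine continuous_iff_continuousAt.2 fun x => tendsto_iff_dist_tendsto_zero.2 ?_
    refine squeeze_zero (fun _ => dist_nonneg) (fun y => h1 _ _) ?_
    simp only [Equiv.invFun_as_coe, Equiv.apply_symm_apply]
    have h : Continuous fun y => (dist y x / c) ^ s :=
      ((continuous_id.dist continuous_const).div_const c).rpow_const fun _ => Or.inr hs.le
    have := h.tendsto x
    rwa [dist_self, zero_div, Real.zero_rpow hs.ne'] at this

lemma isQuasisymmetric_snowflakeHomeo (hc : 0 < c) (hs : 0 < s)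
    (h1 : ∀ x y, dist x y ≤ (dist (e x) (e y) / c) ^ s)
    (h2 : ∀ x y, (dist (e x) (e y) / c) ^ s ≤ 2 * dist x y) :
    IsQuasisymmetric (powerHomeo (1 / s) (one_div_pos.2 hs)) (snowflakeHomeo e hc hs h1 h2) := by
  intro t ht x y z h
  rw [coe_powerHomeo]
  have h0 : 0 ≤ dist (e x) (e z) / c := by positivity
  have h3 : (dist (e x) (e y) / c) ^ s ≤ 2 * t * (dist (e x) (e z) / c) ^ s := by
    have h4 := mul_le_mul_of_nonneg_left (h1 x z) t.2
    have h5 := h2 x y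
    change (t : ℝ) * _ ≤ (t : ℝ) * _ at h4
    linarith
  have h4 := dist_le_of_snowflake hc hs h3
  rw [Real.mul_rpow (by positivity) (by positivity), ← Real.rpow_mul h0,
    mul_one_div_cancel hs.ne', Real.rpow_one] at h4
  refine h4.trans_eq ?_
  change _ = _ * dist (e x) (e z)
  field_simp

end Snowflake

/-! ### The Hamenstädt metric -/

section Hamenstadt

variable {X : Type*} [MetricSpace X] (hd : ∀ x : X, 0 < bdryDist x)
  (hX : ¬ Bornology.IsBounded (Set.univ : Set X))

lemma busemann_endEquiv_none (w x : X) :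
    busemann (jTilde X) (endEquiv hd hX none) w x
      = (Real.log (bdryDist w) - Real.log (bdryDist x)) / 2 := by
  simp only [busemann, gromovProdPt_endEquiv, endPoint, Option.map_none, gromovLim,
    EReal.toReal_coe]
  rw [kernel_comm (w : Completion X)]
  ring

/-- With respect to a Busemann function based at `∞`, the function `ρ_{b,ε}` is a power of a
multiple of the metric of `∂X`. -/
lemma rhoBus_endEquiv (w : X) {ε : ℝ} (hε : 0 < ε) (z z' : MetricBoundary X) :
    rhoBus (jTilde X) (busemann (jTilde X) (endEquiv hd hX none) w) ε
      (endEquiv hd hX (some z)) (endEquiv hd hX (some z'))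
      = (dist z z' / bdryDist w) ^ (ε / 2) := by
  have hb : ∀ x y : X, gromovProdBus (jTilde X) (busemann (jTilde X) (endEquiv hd hX none) w) x y
      = (Real.log (bdryDist w) - Real.log (kernel (x : Completion X) y)) / 2 := fun x y => by
    rw [gromovProdBus, busemann_endEquiv_none, busemann_endEquiv_none, jTilde_eq hd]
    ring
  have hk : Tendsto (fun a : X × X => kernel (a.1 : Completion X) a.2)
      (endFilter (some z.1) ×ˢ endFilter (some z'.1)) (𝓝 (dist z z')) := by
    rw [← kernel_boundary]
    exact tendsto_kernel ((tendsto_coe_endFilter _).comp tendsto_fst)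
      ((tendsto_coe_endFilter _).comp tendsto_snd)
  unfold rhoBus gromovProdBusBdry
  rcases eq_or_ne z z' with rfl | hne
  · rw [iInf_liminf_seqs_eq hd hX (L := ⊤)]
    · rw [EReal.coe_mul_top_of_pos hε, dist_self, zero_div, Real.zero_rpow (by positivity)]
      simp
    · rw [EReal.tendsto_coe_nhds_top_iff]
      simp only [hb, sub_eq_add_neg]
      rw [dist_self] at hk
      have hk' : Tendsto (fun a : X × X => Real.log (kernel (a.1 : Completion X) a.2))
          (endFilter (some z.1) ×ˢ endFilter (some z.1)) atBot :=
        Real.tendsto_log_nhdsGT_zero.comp (tendsto_nhdsWithin_iff.2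
          ⟨hk, Eventually.of_forall fun a => kernel_coe_pos hd _ _⟩)
      exact (tendsto_atTop_add_const_left _ _
        (tendsto_neg_atBot_atTop.comp hk')).atTop_div_const two_pos
  · have hpos := dist_pos.2 hne
    have hw := hd w
    rw [iInf_liminf_seqs_eq hd hX
      (L := (((Real.log (bdryDist w) - Real.log (dist z z')) / 2 : ℝ) : EReal))]
    · rw [← EReal.coe_mul, ← EReal.coe_neg, EReal.exp_coe, ENNReal.toReal_ofReal (Real.exp_nonneg _),
        Real.rpow_def_of_pos (by positivity), Real.log_div hpos.ne' hw.ne']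
      congr 1
      ring
    · simp only [hb]
      exact (continuous_coe_real_ereal.tendsto _).comp
        (((hk.log hpos.ne').const_sub _).div_const 2)

include hd hX

/-- Hyperbolicity seen from a base point going to infinity: `k` is a quasi-ultrametric. -/
lemma log_kernel_le_of_isGromovHyperbolic {δ : ℝ} (h : IsGromovHyperbolic (jTilde X) δ)
    (x y z : X) : Real.log (kernel (x : Completion X) y) ≤ 2 * δ +
      max (Real.log (kernel (x : Completion X) z)) (Real.log (kernel (z : Completion X) y)) := by
  have := endFilter_neBot hX none
  have lim : ∀ a b : X, Tendsto (fun o : X => Real.log (kernel (o : Completion X) a)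
      - Real.log (kernel (o : Completion X) b)) (endFilter none) (𝓝 0) := fun a b => by
    have ha : Tendsto (fun _ : X => a) (endFilter none) (endFilter (some (a : Completion X))) :=
      tendsto_const_pure.mono_right (pure_le_endFilter a)
    have h1 := (tendsto_log_kernel_sub hd b a).comp (tendsto_id.prodMk ha)
    exact h1
  have l1 := (lim y z).const_add (Real.log (kernel (x : Completion X) z))
  have l2 := (lim x z).const_add (Real.log (kernel (z : Completion X) y))
  have l3 := (l1.max l2).const_add (2 * δ)
  rw [add_zero, add_zero] at l3
  refine ge_of_tendsto l3 (Eventually.of_forall fun o => ?_)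
  have h1 := h.2 x y z o
  simp only [gromovProd_jTilde hd] at h1
  rw [kernel_comm (x : Completion X) o, kernel_comm (y : Completion X) o,
    kernel_comm (z : Completion X) o] at h1
  rw [sub_le_iff_le_add, min_le_iff] at h1
  rw [← sub_le_iff_le_add', le_max_iff]
  rcases h1 with h1 | h1
  · left; linarith
  · right; linarith

lemma dist_boundary_le_of_isGromovHyperbolic {δ : ℝ} (h : IsGromovHyperbolic (jTilde X) δ)
    (x y z : MetricBoundary X) : dist x y ≤ Real.exp (2 * δ) * max (dist x z) (dist z y) := by
  have hX' : ∀ a b c : X, kernel (a : Completion X) b ≤ Real.exp (2 * δ) *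
      max (kernel (a : Completion X) c) (kernel (c : Completion X) b) := fun a b c => by
    have h1 := log_kernel_le_of_isGromovHyperbolic hd hX h a b c
    have p1 := kernel_coe_pos hd (a : Completion X) b
    have p2 := kernel_coe_pos hd (a : Completion X) c
    have p3 := kernel_coe_pos hd (c : Completion X) b
    rw [Real.log_le_iff_le_exp p1, Real.exp_add] at h1
    refine h1.trans_eq ?_
    rw [Real.exp_monotone.map_max, Real.exp_log p2, Real.exp_log p3]
  obtain ⟨u, hu⟩ := exists_seq_tendsto_endFilter hX (some x.1)
  obtain ⟨v, hv⟩ := exists_seq_tendsto_endFilter hX (some y.1)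
  obtain ⟨t, ht⟩ := exists_seq_tendsto_endFilter hX (some z.1)
  have hu' := (tendsto_coe_endFilter x.1).comp hu
  have hv' := (tendsto_coe_endFilter y.1).comp hv
  have ht' := (tendsto_coe_endFilter z.1).comp ht
  have k1 := tendsto_kernel hu' hv'
  have k2 := ((tendsto_kernel hu' ht').max (tendsto_kernel ht' hv')).const_mul (Real.exp (2 * δ))
  rw [kernel_boundary] at k1
  rw [kernel_boundary, kernel_boundary] at k2
  exact le_of_tendsto_of_tendsto' k1 k2 fun i => hX' _ _ _

end Hamenstadt

section Punctured

variable {X : Type*} [MetricSpace X] (hd : ∀ x : X, 0 < bdryDist x)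
  (hX : ¬ Bornology.IsBounded (Set.univ : Set X))

/-- The identification of the boundary at infinity without `∞` with the metric boundary. -/
def puncturedEquiv : PuncturedBoundary (endEquiv hd hX none) ≃ MetricBoundary X :=
  (Equiv.ofBijective (fun z : MetricBoundary X =>
      (⟨endEquiv hd hX (some z), by simp⟩ : PuncturedBoundary (endEquiv hd hX none))) <| by
    refine ⟨fun z z' h => ?_, fun ⟨ζ, hζ⟩ => ?_⟩
    · exact Option.some_injective _ ((endEquiv hd hX).injective (congrArg PuncturedBoundary.val h))
    · obtain ⟨o, rfl⟩ := (endEquiv hd hX).surjective ζ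
      match o with
      | none => exact absurd rfl hζ
      | some z => exact ⟨z, rfl⟩).symm

lemma endEquiv_puncturedEquiv (ζ : PuncturedBoundary (endEquiv hd hX none)) :
    endEquiv hd hX (some (puncturedEquiv hd hX ζ)) = ζ.val :=
  congrArg PuncturedBoundary.val ((puncturedEquiv hd hX).symm_apply_apply ζ)

lemma rhoBus_puncturedBoundary (w : X) {ε : ℝ} (hε : 0 < ε)
    (ζ ζ' : PuncturedBoundary (endEquiv hd hX none)) :
    rhoBus (jTilde X) (busemann (jTilde X) (endEquiv hd hX none) w) ε ζ.val ζ'.val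
      = (dist (puncturedEquiv hd hX ζ) (puncturedEquiv hd hX ζ') / bdryDist w) ^ (ε / 2) := by
  rw [← endEquiv_puncturedEquiv, ← endEquiv_puncturedEquiv, rhoBus_endEquiv hd hX w hε]

lemma rhoBus_le_two_mul_sum (w : X) {ε δ : ℝ} (hε : 0 < ε)
    (hδ : IsGromovHyperbolic (jTilde X) δ) (hεδ : Real.exp (22 * ε * δ) ≤ 2)
    (n : ℕ) (c : ℕ → PuncturedBoundary (endEquiv hd hX none)) :
    rhoBus (jTilde X) (busemann (jTilde X) (endEquiv hd hX none) w) ε (c 0).val (c n).val ≤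
      2 * ∑ i ∈ Finset.range n, rhoBus (jTilde X)
        (busemann (jTilde X) (endEquiv hd hX none) w) ε (c i).val (c (i + 1)).val := by
  have hw := hd w
  have hεδ0 : 0 ≤ ε * δ := mul_nonneg hε.le hδ.1
  simp only [rhoBus_puncturedBoundary hd hX w hε]
  refine le_two_mul_sum_chain (K := Real.exp (ε * δ)) (ρ := fun ζ ζ' =>
    (dist (puncturedEquiv hd hX ζ) (puncturedEquiv hd hX ζ') / bdryDist w) ^ (ε / 2))
    (fun _ _ => by positivity) (fun ζ => ?_) (fun ζ ζ' => by rw [dist_comm])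
    (Real.one_le_exp hεδ0) ?_ (fun ζ ζ' ζ'' => ?_) n c
  · rw [dist_self, zero_div, Real.zero_rpow (by positivity)]
  · rw [← Real.exp_add]
    exact (Real.exp_le_exp.2 (by linarith)).trans hεδ
  · set x := puncturedEquiv hd hX ζ
    set y := puncturedEquiv hd hX ζ'
    set z := puncturedEquiv hd hX ζ''
    have h1 := dist_boundary_le_of_isGromovHyperbolic hd hX hδ x y z
    have h2 : ∀ r : ℝ, 0 ≤ r → dist x y ≤ Real.exp (2 * δ) * r →
        (dist x y / bdryDist w) ^ (ε / 2) ≤ Real.exp (ε * δ) * (r / bdryDist w) ^ (ε / 2) := by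
      intro r hr h
      have h3 : dist x y / bdryDist w ≤ Real.exp (2 * δ) * (r / bdryDist w) := by
        rw [mul_div_assoc']
        gcongr
      refine (Real.rpow_le_rpow (by positivity) h3 (by positivity)).trans_eq ?_
      rw [Real.mul_rpow (Real.exp_nonneg _) (by positivity), ← Real.exp_mul]
      congr 2
      ring
    rcases le_total (dist x z) (dist z y) with h | h
    · rw [max_eq_right h] at h1
      refine (h2 _ dist_nonneg h1).trans ?_
      gcongr
      exact le_max_right _ _
    · rw [max_eq_left h] at h1
      refine (h2 _ dist_nonneg h1).trans ?_
      gcongr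
      exact le_max_left _ _

end Punctured

end

/-! ### The natural map is quasisymmetric -/

theorem corollary1p2 :
    ∃ (δ₀ : ℝ) (η : ℝ → (ℝ≥0 ≃ₜ ℝ≥0)), 0 ≤ δ₀ ∧
      ∀ (X : Type u) [MetricSpace X],
        ¬ Bornology.IsBounded (Set.univ : Set X) → ¬ CompleteSpace X →
        (∀ x : X, 0 < bdryDist x) →
        IsMetric (jTilde X) ∧ IsGromovHyperbolic (jTilde X) δ₀ ∧
        ∃ (ψ : GromovClosure (jTilde X) → MetricExt (Completion X))
          (ξ : GromovBoundary (jTilde X)),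
          IsNaturalMap ψ ∧ ψ (GromovClosure.bdry ξ) = MetricExt.infty ∧
          ∀ ε δ : ℝ, 0 < ε → IsGromovHyperbolic (jTilde X) δ → Real.exp (22 * ε * δ) ≤ 2 →
            ∀ b ∈ busemannFunctions (jTilde X) ξ,
              ∃ hm : IsMetric (hamenstadt ξ b ε),
                letI : MetricSpace (PuncturedBoundary ξ) := hm.toMetricSpace
                ∃ φ : PuncturedBoundary ξ ≃ₜ MetricBoundary X,
                  (∀ ζ : PuncturedBoundary ξ, ψ (GromovClosure.bdry ζ.val)
                    = MetricExt.pt (φ ζ : Completion X)) ∧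
                  IsQuasisymmetric (η ε) φ := by
  refine ⟨Real.log 16 / 2, fun ε => if h : 0 < ε then
    powerHomeo (1 / (ε / 2)) (one_div_pos.2 (half_pos h)) else Homeomorph.refl _,
    by have := Real.log_nonneg (show (1 : ℝ) ≤ 16 by norm_num); linarith, ?_⟩
  intro X _ hX _ hd
  refine ⟨isMetric_jTilde hd, isGromovHyperbolic_jTilde hd, naturalMap hd hX, endEquiv hd hX none,
    isNaturalMap_naturalMap hd hX, naturalMap_endEquiv hd hX none, ?_⟩
  rintro ε δ hε hδ hεδ b ⟨w, rfl⟩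
  have hw := hd w
  have hρ := rhoBus_puncturedBoundary hd hX w hε
  set ρ : PuncturedBoundary (endEquiv hd hX none) → PuncturedBoundary (endEquiv hd hX none) → ℝ :=
    fun ζ ζ' => rhoBus (jTilde X) (busemann (jTilde X) (endEquiv hd hX none) w) ε ζ.val ζ'.val
  have hρ' : ∀ ζ ζ', ρ ζ ζ' =
      (dist (puncturedEquiv hd hX ζ) (puncturedEquiv hd hX ζ') / bdryDist w) ^ (ε / 2) := hρ
  have h0 : ∀ ζ ζ', 0 ≤ ρ ζ ζ' := fun ζ ζ' => by rw [hρ']; positivity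
  have hle : ∀ ζ ζ', ρ ζ ζ' ≤ 2 * chainInf ρ ζ ζ' := fun ζ ζ' => by
    have h : ρ ζ ζ' / 2 ≤ chainInf ρ ζ ζ' := by
      refine le_chainInf fun n c _ h1 h2 => ?_
      have h3 := rhoBus_le_two_mul_sum hd hX w hε hδ hεδ n c
      rw [h1, h2] at h3
      linarith
    linarith
  -- the Hamenstädt metric is by definition the chain infimum of `ρ`
  have hm : IsMetric (hamenstadt (endEquiv hd hX none)
      (busemann (jTilde X) (endEquiv hd hX none) w) ε) := by
    refine isMetric_chainInf (ρ := ρ) h0 (fun ζ ζ' => ?_) (fun ζ ζ' => ?_) hle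
    · rw [hρ', Real.rpow_eq_zero (by positivity) (by positivity), div_eq_zero_iff,
        or_iff_left hw.ne', dist_eq_zero, EmbeddingLike.apply_eq_iff_eq]
    · rw [hρ', hρ', dist_comm]
  refine ⟨hm, ?_⟩
  let : MetricSpace (PuncturedBoundary (endEquiv hd hX none)) := hm.toMetricSpace
  have e1 : ∀ ζ ζ' : PuncturedBoundary (endEquiv hd hX none), dist ζ ζ' ≤
      (dist (puncturedEquiv hd hX ζ) (puncturedEquiv hd hX ζ') / bdryDist w) ^ (ε / 2) :=
    fun ζ ζ' => (chainInf_le h0 ζ ζ').trans_eq (hρ' ζ ζ')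
  have e2 : ∀ ζ ζ' : PuncturedBoundary (endEquiv hd hX none),
      (dist (puncturedEquiv hd hX ζ) (puncturedEquiv hd hX ζ') / bdryDist w) ^ (ε / 2)
        ≤ 2 * dist ζ ζ' :=
    fun ζ ζ' => (hρ' ζ ζ').symm.trans_le (hle ζ ζ')
  refine ⟨snowflakeHomeo (puncturedEquiv hd hX) hw (half_pos hε) e1 e2, fun ζ => ?_, ?_⟩
  · rw [← endEquiv_puncturedEquiv, naturalMap_endEquiv]
    rfl
  · beta_reduce
    rw [dif_pos hε]
    exact isQuasisymmetric_snowflakeHomeo hw (half_pos hε) e1 e2
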